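/- **Setting.** A network is a finite connected undirected graph $G=(V,E)$ with a root $t$ and edge costs $c_e\ge 0$. For a set $S\subseteq V\setminus\{t\}$ of activated vertices, each $s\in S$ is a player who chooses a path $P_s$ from $s$ to $t$. An *ordered* universal cost-sharing protocol fixes, knowing $G$ but not $S$, a total order $\pi$ of $V$; the full cost $c_e$ of each used edge is then charged to the $\pi$-first player using $e$. (It is the generalized weighted Shapley protocol whose ordered partition consists of singletons.) A pure Nash equilibrium is an outcome $P=(P_s)_{s\in S}$ in which no player can lower the total of her shares by changing her path alone. The cost $c(P)$ of an outcome is the total cost of the edges in $\bigcup_s P_s$, $\mathrm{opt}(S)$ is the minimum cost of an outcome, and the Price of Anarchy for $S$ is the maximum of $c(P)/\mathrm{opt}(S)$ over all pure Nash equilibria $P$. **Theorem.** There is an absolute constant $c>0$ such that the following hold. 1. For every integer $k\ge 2$ there is a network such that for every ordered universal cost-sharing protocol on it there is a set $S\subseteq V\setminus\{t\}$ with exactly $k$ activated vertices, $\mathrm{opt}(S)>0$, for which the Price of Anarchy is at least $c\log k$. 2. For $k=2^r+1$, $r\ge 1$, the network can be chosen as follows, for a suitable $n=n(r)$: its vertices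 are those of the hypercube $Q_n$ together with $t$; every two vertices are joined by an edge, whose cost is $2^r$ if one endpoint is $t$, and the hypercube (Hamming) distance of the endpoints otherwise. For every ordered protocol, with order $\pi$, one can take as $S$ the vertex set of a path $(v_0,\dots,v_{2^r})$ of $Q_n$ that is isometric, i.e. $d_{Q_n}(v_a,v_b)=|a-b|$ for all $a,b$, and zig-zag with respect to $\pi$: if $1\le j\le r$ and $a$ is divisible by $2^{r-j}$ but not by $2^{r-j+1}$, then $v_{a-2^{r-j}}$ and $v_{a+2^{r-j}}$ both precede $v_a$ in $\pi$. -/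

import Mathlib

open scoped ENNReal NNReal

/-- A rooted undirected network: a connected graph with a root and nonnegative edge costs.
The values of `cost` outside `graph.edgeSet` are never used. -/
structure Network (V : Type*) where
  graph : SimpleGraph V
  connected : graph.Connected
  root : V
  cost : Sym2 V → ℝ
  cost_nonneg : ∀ e ∈ graph.edgeSet, 0 ≤ cost e

/-- A cost-sharing protocol on the potential players `V`: `ξ e R i` is the share of the edge `e`
paid by the player `i` when `R` is the set of players using `e`. -/
abbrev CostSharingProtocol (V : Type*) := Sym2 V → Finset V → V → ℝ

/-- The data of a generalized weighted Shapley protocol on the potential players `V`: positive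
weights, and an ordered partition of `V` given by `rank` (its blocks are the nonempty fibres of
`rank`, a smaller rank coming earlier). -/
structure GWSP (V : Type*) where
  weight : V → ℝ
  weight_pos : ∀ v, 0 < weight v
  rank : V → ℕ

namespace GWSP

variable {V : Type*}

/-- The users in `R` that belong to the earliest block meeting `R`. -/
def firstBlock (Ξ : GWSP V) (R : Finset V) : Finset V :=
  R.filter fun i => ∀ j ∈ R, Ξ.rank i ≤ Ξ.rank j

/-- The generalized weighted Shapley protocol on the network `N`: the cost of an edge is split
among the users of the earliest block, proportionally to their weights. -/
noncomputable def toProtocol [DecidableEq V] (Ξ : GWSP V) (N : Network V) :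
    CostSharingProtocol V := fun e R i =>
  if i ∈ Ξ.firstBlock R then Ξ.weight i / (∑ j ∈ Ξ.firstBlock R, Ξ.weight j) * N.cost e else 0

/-- The protocol is ordered: every block is a single player. -/
def IsOrdered (Ξ : GWSP V) : Prop := Function.Injective Ξ.rank

end GWSP

namespace Network

variable {V : Type*} [DecidableEq V]

/-- A strategy profile for the set `S` of activated vertices: every activated vertex chooses a
(simple) path to the root. -/
abbrev Profile (N : Network V) (S : Finset V) := ∀ i : S, N.graph.Path (i : V) N.root

/-- The set of players whose path uses the edge `e`. -/
def users (N : Network V) {S : Finset V} (P : N.Profile S) (e : Sym2 V) : Finset V :=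
  (Finset.univ.filter fun i : S => e ∈ (P i).1.edges).map (Function.Embedding.subtype _)

/-- The cost share of player `i` in the profile `P`. -/
noncomputable def playerCost (N : Network V) (ξ : CostSharingProtocol V) {S : Finset V}
    (P : N.Profile S) (i : S) : ℝ :=
  ∑ e ∈ (P i).1.edges.toFinset, ξ e (N.users P e) i

/-- Pure Nash equilibria. -/
def IsNash (N : Network V) (ξ : CostSharingProtocol V) {S : Finset V} (P : N.Profile S) : Prop :=
  ∀ (i : S) (p : N.graph.Path (i : V) N.root),
    N.playerCost ξ P i ≤ N.playerCost ξ (Function.update P i p) i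

/-- The cost of an outcome: the total cost of the union of the chosen paths. -/
noncomputable def socialCost (N : Network V) {S : Finset V} (P : N.Profile S) : ℝ :=
  ∑ e ∈ Finset.univ.biUnion (fun i : S => (P i).1.edges.toFinset), N.cost e

/-- The cost of an optimal outcome. -/
noncomputable def opt (N : Network V) (S : Finset V) : ℝ :=
  ⨅ P : N.Profile S, N.socialCost P

/-- The Price of Anarchy of the protocol `ξ` when exactly the vertices of `S` are activated. -/
noncomputable def priceOfAnarchy (N : Network V) (ξ : CostSharingProtocol V) (S : Finset V) :
    ℝ≥0∞ :=
  ⨆ P : {P : N.Profile S // N.IsNash ξ P},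
    ENNReal.ofReal (N.socialCost P.1) / ENNReal.ofReal (N.opt S)

end Network

/-- The `n`-dimensional hypercube with a root `none` added. Any two vertices are joined by an
edge; its cost is `ρ` if one of them is the root, and their hypercube distance otherwise. -/
noncomputable def rootedHypercube (n : ℕ) (ρ : ℝ≥0) :
    Network (Option (Fin n → Bool)) where
  graph := ⊤
  connected := SimpleGraph.connected_top
  root := none
  cost := Sym2.lift ⟨fun
    | some x, some y => (hammingDist x y : ℝ)
    | _, _ => (ρ : ℝ), by
      rintro (_ | x) (_ | y) <;> simp [hammingDist_comm]⟩
  cost_nonneg := by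
    intro e _
    induction e with
    | _ x y => rcases x with _ | x <;> rcases y with _ | y <;> simp

/-- The sequence `p 0, …, p (2 ^ r)` is an isometric path of the `n`-dimensional hypercube. -/
def IsIsometricPath {n r : ℕ} (p : Fin (2 ^ r + 1) → Fin n → Bool) : Prop :=
  ∀ a b, hammingDist (p a) (p b) = Nat.dist a b

/-- The labels `l 0, …, l (2 ^ r)` along a path are zig-zag. For `1 ≤ j ≤ r`, the class `j`
consists of the positions divisible by `2 ^ (r - j)` and not by `2 ^ (r - j + 1)`; the parents of
such a position are the two positions at distance `2 ^ (r - j)` from it, and their labels have to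
be smaller. -/
def IsZigZag {r : ℕ} (l : Fin (2 ^ r + 1) → ℕ) : Prop :=
  ∀ j, 1 ≤ j → j ≤ r → ∀ a : Fin (2 ^ r + 1),
    (a : ℕ) % 2 ^ (r - j) = 0 → (a : ℕ) % 2 ^ (r - j + 1) ≠ 0 →
      ∀ b : Fin (2 ^ r + 1), Nat.dist a b = 2 ^ (r - j) → l b < l a

/-!
In an ordered protocol the first player on an edge pays all of it. Along a zig-zag isometric path
of length `2 ^ r`, join every position `a` to a parent at distance `gcd a (2 ^ r)`, and the ends to
the root. Every activated vertex ranked before `a` is at least this far from `a`: walking from a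
closer position to its parents would only lead to earlier positions even closer to `a`, and finally
to `a` itself. So no deviation pays off, and this equilibrium costs about `r * 2 ^ r / 2`, while
following the path to a single root edge costs at most `2 * 2 ^ r`. Initial segments of the path
give all numbers of players.

A zig-zag path of length `2 ^ (r + 1)` is obtained from one of length `2 ^ r` by an embedding of
hypercubes that doubles the distances and sends neighbours to vertices with a common neighbour that
comes later. By Ramsey's theorem, on many coordinates it only depends on the position of an element
whether deleting it from a set of a given size lowers the rank. Encode a point by the choice of one
element from each of many consecutive pairs, so that neighbours differ in one pair. The later common
neighbour is then their intersection if deleting at the position of this pair does not lower the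
rank, and their union if deleting at this position and at the next one does; one of the two cases is
available for enough coordinates.
-/

section Ramsey

open Finset

universe u

variable {κ : Type*}

/-- The partition relation `n → (m)ᵏ` of Ramsey theory, for the subsets of `α` and the colours `κ`:
for every colouring of the finite sets, every set of at least `n` elements has a subset of `m`
elements all of whose `k`-element subsets have the same colour. -/
def Arrows (α κ : Type*) (n m k : ℕ) : Prop :=
  ∀ A : Finset α, n ≤ #A → ∀ c : Finset α → κ,
    ∃ M ⊆ A, #M = m ∧ ∃ a, ∀ s ⊆ M, #s = k → c s = a

theorem exists_color_insert_eq_of_forall_lt {k : ℕ}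
    (hk : ∀ m, ∃ n, ∀ α : Type u, Arrows α κ n m k) (m : ℕ) :
    ∃ n, ∀ (α : Type u) [LinearOrder α] (A : Finset α), n ≤ #A → ∀ c : Finset α → κ,
      ∃ M ⊆ A, #M = m ∧ ∃ g : α → κ, ∀ x ∈ M, ∀ s ⊆ M, #s = k → (∀ y ∈ s, x < y) →
        c (insert x s) = g x := by
  induction m with
  | zero => exact ⟨0, fun _ _ A _ c => ⟨∅, empty_subset A, rfl, fun x => c {x}, by simp⟩⟩
  | succ m ih =>
    obtain ⟨n₀, h₀⟩ := ih
    obtain ⟨n₁, h₁⟩ := hk n₀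
    refine ⟨n₁ + 1, fun α _ A hA c => ?_⟩
    have hne : A.Nonempty := card_pos.1 (by omega)
    set x := A.min' hne
    have hxA : x ∈ A := A.min'_mem hne
    obtain ⟨M₁, hM₁, hcard₁, a, ha⟩ := h₁ α (A.erase x) (by rw [card_erase_of_mem hxA]; omega)
      (fun s => c (insert x s))
    obtain ⟨M, hM, hcard, g, hg⟩ := h₀ α M₁ hcard₁.ge c
    have hlt : ∀ y ∈ M, x < y := fun y hy => A.min'_lt_of_mem_erase_min' hne (hM₁ (hM hy))
    have hxM : x ∉ M := fun h => (hlt x h).false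
    refine ⟨insert x M, insert_subset hxA ((hM.trans hM₁).trans (erase_subset x A)),
      by rw [card_insert_of_notMem hxM, hcard], Function.update g x a, ?_⟩
    intro y hy s hs hsk hys
    have hsM : s ⊆ M := by
      refine (subset_insert_iff_of_notMem fun hxs => ?_).1 hs
      rcases mem_insert.1 hy with rfl | hyM
      exacts [(hys _ hxs).false, (hys _ hxs).asymm (hlt y hyM)]
    rcases mem_insert.1 hy with rfl | hyM
    · rw [Function.update_self]
      exact ha s (hsM.trans hM) hsk
    · rw [Function.update_of_ne (hlt y hyM).ne']
      exact hg y hyM s hsM hsk hys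

theorem exists_arrows [Finite κ] (k m : ℕ) :
    ∃ n, ∀ α : Type u, Arrows α κ n m k := by
  classical
  have := Fintype.ofFinite κ
  induction k generalizing m with
  | zero =>
    refine ⟨m, fun _ A hA c => ?_⟩
    obtain ⟨M, hM, hcard⟩ := exists_subset_card_eq hA
    exact ⟨M, hM, hcard, c ∅, fun s _ hs => by rw [card_eq_zero.1 hs]⟩
  | succ k ih =>
    obtain ⟨n, hn⟩ := exists_color_insert_eq_of_forall_lt ih (Fintype.card κ * m)
    refine ⟨n, fun α A hA c => ?_⟩
    let _ : LinearOrder α := IsWellOrder.linearOrder WellOrderingRel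
    obtain ⟨M, hM, hcard, g, hg⟩ := hn α A hA c
    obtain ⟨a, -, ha⟩ := exists_le_card_fiber_of_mul_le_card_of_maps_to
      (f := g) (fun x _ => mem_univ (g x)) ⟨c ∅, mem_univ _⟩ (by rw [hcard, card_univ])
    obtain ⟨M', hM', hcard'⟩ := exists_subset_card_eq ha
    have hM'M : M' ⊆ M := hM'.trans (filter_subset _ _)
    refine ⟨M', hM'M.trans hM, hcard', a, fun s hs hsk => ?_⟩
    have hne : s.Nonempty := card_pos.1 (by omega)
    have hmin := s.min'_mem hne
    calc c s = c (insert (s.min' hne) (s.erase (s.min' hne))) := by rw [insert_erase hmin]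
      _ = g (s.min' hne) := hg _ (hM'M (hs hmin)) _
        (((erase_subset _ s).trans hs).trans hM'M) (by rw [card_erase_of_mem hmin]; omega)
        (fun y hy => s.min'_lt_of_mem_erase_min' hne hy)
      _ = a := (mem_filter.1 (hM' (hs hmin))).2

end Ramsey

section Position

open Finset

variable {α β : Type*} [LinearOrder α] [LT β]

/-- Whether deleting an element from a `D`-element set lowers the label `L` depends only on the
position of this element in the set, counted from `0`: it does so at the positions in `C`. -/
def IsPositionInvariant (L : Finset α → β) (D : ℕ) (C : Set ℕ) : Prop :=
  ∀ z : Finset α, #z = D → ∀ i ∈ z, L (z.erase i) < L z ↔ #{j ∈ z | j < i} ∈ C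

theorem card_filter_lt_map {γ : Type*} [LinearOrder γ] (t : α ↪o γ) (z : Finset α) (i : α) :
    #{j ∈ z.map t.toEmbedding | j < t i} = #{j ∈ z | j < i} := by
  simp only [filter_map, card_map, Function.comp_def, RelEmbedding.coe_toEmbedding, t.lt_iff_lt]

theorem IsPositionInvariant.comp_map {γ : Type*} [LinearOrder γ] {L : Finset γ → β} {D : ℕ}
    {C : Set ℕ} (hL : IsPositionInvariant L D C) (t : α ↪o γ) :
    IsPositionInvariant (fun z => L (z.map t.toEmbedding)) D C := by
  intro z hz i hi
  simp only [map_erase]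
  rw [← card_filter_lt_map t]
  exact hL _ (by rw [card_map, hz]) _ (mem_map_of_mem _ hi)

theorem strictMonoOn_card_filter_lt (z : Finset α) :
    StrictMonoOn (fun i => #{j ∈ z | j < i}) z := by
  intro i hi k _ hik
  refine card_lt_card ⟨monotone_filter_right z fun j _ hji => lt_trans hji hik, fun h => ?_⟩
  exact (mem_filter.1 (h (mem_filter.2 ⟨hi, hik⟩))).2.false

theorem card_filter_lt_lt_card {z : Finset α} {i : α} (hi : i ∈ z) : #{j ∈ z | j < i} < #z :=
  card_lt_card (filter_ssubset.2 ⟨i, hi, lt_irrefl i⟩)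

theorem exists_isPositionInvariant (D m : ℕ) :
    ∃ n, ∀ L : Finset (Fin n) → β, ∃ (t : Fin m ↪o Fin n) (C : Set ℕ),
      IsPositionInvariant (fun z => L (z.map t.toEmbedding)) D C := by
  classical
  obtain ⟨n, hn⟩ := exists_arrows (κ := Set (Fin D)) D m
  refine ⟨n, fun L => ?_⟩
  obtain ⟨M, -, hcard, a, ha⟩ := hn (Fin n) univ (card_fin n).ge fun z =>
    {p | ∃ i ∈ z, #{j ∈ z | j < i} = p ∧ L (z.erase i) < L z}
  refine ⟨M.orderEmbOfFin hcard, Fin.val '' a, fun z hz i hi => ?_⟩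
  set t := M.orderEmbOfFin hcard
  have hzM : z.map t.toEmbedding ⊆ M :=
    map_subset_iff_subset_preimage.2 fun j _ => mem_preimage.2 (M.orderEmbOfFin_mem hcard j)
  have hti : t i ∈ z.map t.toEmbedding := mem_map_of_mem _ hi
  have hposition : #{j ∈ z | j < i} < D := hz ▸ card_filter_lt_lt_card hi
  have hcolor : #{j ∈ z | j < i} ∈ Fin.val '' a ↔ ∃ x ∈ z.map t.toEmbedding,
      #{y ∈ z.map t.toEmbedding | y < x} = #{y ∈ z.map t.toEmbedding | y < t i} ∧
        L ((z.map t.toEmbedding).erase x) < L (z.map t.toEmbedding) := by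
    rw [← ha _ hzM (by rw [card_map, hz]), ← Fin.val_mk hposition,
      Fin.val_injective.mem_set_image, card_filter_lt_map]
    rfl
  simp only [map_erase]
  rw [hcolor]
  refine ⟨fun h => ⟨t i, hti, rfl, h⟩, ?_⟩
  rintro ⟨j, hj, hji, h⟩
  rwa [(strictMonoOn_card_filter_lt _).injOn hj hti hji] at h

end Position

section Cube

open Finset

/-- The vertex of the hypercube on the coordinates `α` that corresponds to a set of coordinates. -/
def cubePoint {α : Type*} [DecidableEq α] (A : Finset α) : α → Bool := fun i => decide (i ∈ A)

theorem cubePoint_injective {α : Type*} [DecidableEq α] :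
    Function.Injective (cubePoint : Finset α → α → Bool) := fun A B h => by
  ext i
  simpa [cubePoint] using congrFun h i

theorem hammingDist_cubePoint {α : Type*} [Fintype α] [DecidableEq α] (A B : Finset α) :
    hammingDist (cubePoint A) (cubePoint B) = #(symmDiff A B) := by
  rw [hammingDist]
  congr 1
  ext i
  by_cases hA : i ∈ A <;> by_cases hB : i ∈ B <;> simp [cubePoint, mem_symmDiff, hA, hB]

theorem cubePoint_filter {α : Type*} [Fintype α] [DecidableEq α] (x : α → Bool) :
    cubePoint {i | x i} = x := by
  ext i
  simp [cubePoint]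

end Cube

section Transversal

open Finset

variable {N : ℕ}

/-- The choice of one element from each of the pairs `{(i, false), (i, true)}` that is encoded by a
set `A` of indices. The pairs follow each other in the lexicographic order. -/
def transversalEmbedding (A : Finset (Fin N)) : Fin N ↪o Fin N ×ₗ Bool :=
  OrderEmbedding.ofStrictMono (fun i => toLex (i, decide (i ∈ A))) fun _ _ h =>
    Prod.Lex.toLex_lt_toLex.2 (Or.inl h)

theorem transversalEmbedding_apply (A : Finset (Fin N)) (i : Fin N) :
    transversalEmbedding A i = toLex (i, decide (i ∈ A)) :=
  rfl

/-- The set of the elements chosen by `transversalEmbedding A`. Replacing `A` by a neighbour in the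
hypercube exchanges the two elements of one pair. -/
def transversal (A : Finset (Fin N)) : Finset (Fin N ×ₗ Bool) :=
  univ.map (transversalEmbedding A).toEmbedding

theorem mem_transversal {A : Finset (Fin N)} {i : Fin N} {b : Bool} :
    toLex (i, b) ∈ transversal A ↔ b = decide (i ∈ A) := by
  simp [transversal, transversalEmbedding_apply, eq_comm]

theorem transversalEmbedding_mem (A : Finset (Fin N)) (i : Fin N) :
    transversalEmbedding A i ∈ transversal A :=
  mem_map_of_mem _ (mem_univ i)

theorem card_transversal (A : Finset (Fin N)) : #(transversal A) = N := by
  rw [transversal, card_map, card_fin]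

theorem card_symmDiff_transversal (A B : Finset (Fin N)) :
    #(symmDiff (transversal A) (transversal B)) = 2 * #(symmDiff A B) := by
  have h : symmDiff (transversal A) (transversal B) =
      (symmDiff A B ×ˢ (univ : Finset Bool)).map toLex.toEmbedding := by
    ext p
    induction p with | _ p =>
    obtain ⟨i, b⟩ := p
    by_cases hA : i ∈ A <;> by_cases hB : i ∈ B <;> cases b <;>
      simp [mem_symmDiff, mem_transversal, hA, hB]
  rw [h, card_map, card_product, card_univ, Fintype.card_bool, mul_comm]

theorem card_filter_lt_transversalEmbedding (A : Finset (Fin N)) (q : Fin N) :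
    #{p ∈ transversal A | p < transversalEmbedding A q} = q := by
  rw [transversal, card_filter_lt_map, ← Fin.card_Iio q]
  congr 1
  ext i
  simp

theorem card_filter_transversal_lt (A : Finset (Fin N)) (q : Fin N) (b : Bool) :
    #{p ∈ transversal A | p < toLex (q, b)} = q ∨
      #{p ∈ transversal A | p < toLex (q, b)} = q + 1 := by
  set I : Finset (Fin N) := {i | transversalEmbedding A i < toLex (q, b)}
  have hcard : #{p ∈ transversal A | p < toLex (q, b)} = #I := by
    rw [transversal, filter_map, card_map]
    rfl
  have hlower : #(Iio q) ≤ #I := card_le_card fun i hi =>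
    mem_filter.2 ⟨mem_univ i, Prod.Lex.toLex_lt_toLex.2 (Or.inl (mem_Iio.1 hi))⟩
  have hupper : #I ≤ #(Iic q) := card_le_card fun i hi => by
    rcases Prod.Lex.toLex_lt_toLex.1 (mem_filter.1 hi).2 with h | h
    exacts [mem_Iic.2 h.le, mem_Iic.2 h.1.le]
  rw [Fin.card_Iio] at hlower
  rw [Fin.card_Iic] at hupper
  omega

variable {A B : Finset (Fin N)} {q : Fin N}

theorem transversal_inter (h : symmDiff A B = {q}) :
    transversal A ∩ transversal B = (transversal A).erase (transversalEmbedding A q) := by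
  ext p
  induction p with | _ p =>
  obtain ⟨i, b⟩ := p
  have hi : i ∈ symmDiff A B ↔ i = q := by rw [h, mem_singleton]
  simp only [mem_symmDiff] at hi
  simp only [mem_inter, mem_erase, mem_transversal, transversalEmbedding_apply, toLex_inj,
    Prod.mk.injEq, ne_eq]
  grind

theorem transversal_union (h : symmDiff A B = {q}) :
    transversal A ∪ transversal B = insert (transversalEmbedding B q) (transversal A) := by
  ext p
  induction p with | _ p =>
  obtain ⟨i, b⟩ := p
  have hi : i ∈ symmDiff A B ↔ i = q := by rw [h, mem_singleton]
  simp only [mem_symmDiff] at hi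
  simp only [mem_union, mem_insert, mem_transversal, transversalEmbedding_apply, toLex_inj,
    Prod.mk.injEq]
  grind

theorem transversalEmbedding_notMem (h : symmDiff A B = {q}) :
    transversalEmbedding B q ∉ transversal A := by
  have hq : q ∈ symmDiff A B := by rw [h, mem_singleton]
  rw [transversalEmbedding_apply, mem_transversal]
  simp only [mem_symmDiff] at hq
  grind

theorem card_symmDiff_transversal_inter (h : symmDiff A B = {q}) :
    #(symmDiff (transversal A) (transversal A ∩ transversal B)) = 1 := by
  rw [transversal_inter h, symmDiff_of_ge (erase_subset _ _),
    sdiff_erase_self (transversalEmbedding_mem A q), card_singleton]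

theorem card_symmDiff_transversal_union (h : symmDiff A B = {q}) :
    #(symmDiff (transversal A) (transversal A ∪ transversal B)) = 1 := by
  rw [transversal_union h, symmDiff_of_le (subset_insert _ _),
    insert_sdiff_cancel (transversalEmbedding_notMem h), card_singleton]

variable {C : Set ℕ}

theorem IsPositionInvariant.lt_transversal_inter {β : Type*} [LinearOrder β]
    {L : Finset (Fin N ×ₗ Bool) → β} (hL : IsPositionInvariant L N C)
    (hinj : Function.Injective L) (hq : (q : ℕ) ∉ C) (h : symmDiff A B = {q}) :
    L (transversal A) < L (transversal A ∩ transversal B) := by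
  rw [transversal_inter h]
  have hmem := transversalEmbedding_mem A q
  refine lt_of_le_of_ne (not_lt.1 ?_) (hinj.ne (erase_ne_self.2 hmem).symm)
  rwa [hL _ (card_transversal A) _ hmem, card_filter_lt_transversalEmbedding]

theorem IsPositionInvariant.lt_transversal_union {β : Type*} [LT β]
    {L : Finset (Fin N ×ₗ Bool) → β} (hL : IsPositionInvariant L (N + 1) C)
    (hq : (q : ℕ) ∈ C) (hq' : (q : ℕ) + 1 ∈ C) (h : symmDiff A B = {q}) :
    L (transversal A) < L (transversal A ∪ transversal B) := by
  have hmem := transversalEmbedding_notMem h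
  have hlt := hL (insert (transversalEmbedding B q) (transversal A))
    (by rw [card_insert_of_notMem hmem, card_transversal]) _ (mem_insert_self _ _)
  rw [erase_insert hmem, filter_insert, if_neg (lt_irrefl _)] at hlt
  rw [transversal_union h, hlt]
  rcases card_filter_transversal_lt A q (decide (q ∈ B)) with hcard | hcard
  exacts [hcard.symm ▸ hq, hcard.symm ▸ hq']

end Transversal

section Peak

open Finset

theorem exists_embedding_of_le_card_filter {m N : ℕ} (p : Fin N → Prop) [DecidablePred p]
    (h : m ≤ #{q | p q}) : ∃ σ : Fin m ↪ Fin N, ∀ a, p (σ a) := by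
  obtain ⟨σ⟩ := Function.Embedding.nonempty_of_card_le (α := Fin m) (β := {q // p q})
    (by rwa [Fintype.card_fin, Fintype.card_subtype])
  exact ⟨σ.trans (Function.Embedding.subtype p), fun a => (σ a).2⟩

theorem exists_embedding_notMem_or_consecutive_mem (C : Set ℕ) (m : ℕ) :
    (∃ σ : Fin m ↪ Fin (3 * m + 1), ∀ a, (σ a : ℕ) ∉ C) ∨
      ∃ σ : Fin m ↪ Fin (3 * m), ∀ a, (σ a : ℕ) ∈ C ∧ (σ a : ℕ) + 1 ∈ C := by
  classical
  by_cases hout : m ≤ #{q : Fin (3 * m + 1) | (q : ℕ) ∉ C}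
  · exact Or.inl (exists_embedding_of_le_card_filter _ hout)
  refine Or.inr (exists_embedding_of_le_card_filter (fun q => (q : ℕ) ∈ C ∧ (q : ℕ) + 1 ∈ C) ?_)
  have hfirst : #{q : Fin (3 * m) | (q : ℕ) ∉ C} ≤ #{q : Fin (3 * m + 1) | (q : ℕ) ∉ C} :=
    card_le_card_of_injOn Fin.castSucc (fun q hq => by simpa using hq)
      (Fin.castSucc_injective _).injOn
  have hsecond : #{q : Fin (3 * m) | (q : ℕ) + 1 ∉ C} ≤ #{q : Fin (3 * m + 1) | (q : ℕ) ∉ C} :=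
    card_le_card_of_injOn Fin.succ (fun q hq => by simpa using hq)
      (Fin.succ_injective _).injOn
  have hcover : (univ : Finset (Fin (3 * m))) ⊆
      univ.filter (fun q => (q : ℕ) ∈ C ∧ (q : ℕ) + 1 ∈ C) ∪ univ.filter (fun q => (q : ℕ) ∉ C) ∪
        univ.filter (fun q => (q : ℕ) + 1 ∉ C) :=
    fun q _ => by
      simp only [mem_union, mem_filter_univ]
      tauto
  have hcard := (card_le_card hcover).trans
    ((card_union_le _ _).trans (Nat.add_le_add_right (card_union_le _ _) _))
  rw [card_fin] at hcard
  omega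

variable {β : Type*} [LT β]

/-- The set `Z` is a common neighbour of `A` and `B` in the hypercube of the subsets of `α`, and
its label is larger than theirs. -/
def IsPeak {α : Type*} [DecidableEq α] (L : Finset α → β) (A B Z : Finset α) : Prop :=
  #(symmDiff A Z) = 1 ∧ #(symmDiff B Z) = 1 ∧ L A < L Z ∧ L B < L Z

variable {N : ℕ} {C : Set ℕ} {A B : Finset (Fin N)} {q : Fin N}

theorem IsPositionInvariant.isPeak_inter {β : Type*} [LinearOrder β]
    {L : Finset (Fin N ×ₗ Bool) → β} (hL : IsPositionInvariant L N C)
    (hinj : Function.Injective L) (hq : (q : ℕ) ∉ C) (h : symmDiff A B = {q}) :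
    IsPeak L (transversal A) (transversal B) (transversal A ∩ transversal B) := by
  have h' : symmDiff B A = {q} := symmDiff_comm A B ▸ h
  refine ⟨card_symmDiff_transversal_inter h, ?_, hL.lt_transversal_inter hinj hq h, ?_⟩
  · rw [inter_comm, card_symmDiff_transversal_inter h']
  · rw [inter_comm]
    exact hL.lt_transversal_inter hinj hq h'

theorem IsPositionInvariant.isPeak_union {L : Finset (Fin N ×ₗ Bool) → β}
    (hL : IsPositionInvariant L (N + 1) C)
    (hq : (q : ℕ) ∈ C) (hq' : (q : ℕ) + 1 ∈ C) (h : symmDiff A B = {q}) :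
    IsPeak L (transversal A) (transversal B) (transversal A ∪ transversal B) := by
  have h' : symmDiff B A = {q} := symmDiff_comm A B ▸ h
  refine ⟨card_symmDiff_transversal_union h, ?_, hL.lt_transversal_union hq hq' h, ?_⟩
  · rw [union_comm, card_symmDiff_transversal_union h']
  · rw [union_comm]
    exact hL.lt_transversal_union hq hq' h'

theorem map_symmDiff_finset {α γ : Type*} [DecidableEq α] [DecidableEq γ] (f : α ↪ γ)
    (A B : Finset α) : (symmDiff A B).map f = symmDiff (A.map f) (B.map f) := by
  simp only [map_eq_image, image_symmDiff A B f.injective]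

theorem card_symmDiff_map {α γ : Type*} [DecidableEq α] [DecidableEq γ] (f : α ↪ γ)
    (A B : Finset α) : #(symmDiff (A.map f) (B.map f)) = #(symmDiff A B) := by
  rw [← map_symmDiff_finset, card_map]

theorem IsPeak.map {α γ : Type*} [DecidableEq α] [DecidableEq γ] {L : Finset γ → β} {f : α ↪ γ}
    {A B Z : Finset α} (h : IsPeak (fun z => L (z.map f)) A B Z) :
    IsPeak L (A.map f) (B.map f) (Z.map f) := by
  simpa only [IsPeak, card_symmDiff_map] using h

/-- A map between hypercubes that doubles the distances, and for which the images of neighbours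
have a common neighbour with a larger label than theirs. -/
structure IsPeakedDoubling {m n : ℕ} (l : (Fin n → Bool) → β)
    (ι : (Fin m → Bool) → Fin n → Bool) : Prop where
  hammingDist_map : ∀ x y, hammingDist (ι x) (ι y) = 2 * hammingDist x y
  exists_peak : ∀ x y, hammingDist x y = 1 → ∃ z,
    hammingDist (ι x) z = 1 ∧ hammingDist z (ι y) = 1 ∧ l (ι x) < l z ∧ l (ι y) < l z

theorem IsPeakedDoubling.injective {m n : ℕ} {l : (Fin n → Bool) → β}
    {ι : (Fin m → Bool) → Fin n → Bool} (hι : IsPeakedDoubling l ι) : Function.Injective ι :=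
  fun x y h => by simpa [h] using hι.hammingDist_map x y

theorem isPeakedDoubling_of_isPeak {m n : ℕ} {l : (Fin n → Bool) → β} (σ : Fin m ↪ Fin N)
    (t : Fin N ×ₗ Bool ↪ Fin n)
    (hpeak : ∀ a A B, symmDiff A B = {σ a} →
      ∃ Z, IsPeak (fun z => l (cubePoint (z.map t))) (transversal A) (transversal B) Z) :
    IsPeakedDoubling l fun x : Fin m → Bool =>
      cubePoint ((transversal (({a | x a} : Finset (Fin m)).map σ)).map t) where
  hammingDist_map x y := by
    rw [hammingDist_cubePoint, card_symmDiff_map, card_symmDiff_transversal, card_symmDiff_map,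
      ← hammingDist_cubePoint, cubePoint_filter, cubePoint_filter]
  exists_peak x y hxy := by
    rw [← cubePoint_filter x, ← cubePoint_filter y, hammingDist_cubePoint, card_eq_one] at hxy
    obtain ⟨a, ha⟩ := hxy
    obtain ⟨Z, hZ⟩ := hpeak a (({a | x a} : Finset (Fin m)).map σ) (({a | y a} : Finset _).map σ)
      (by rw [← map_symmDiff_finset, ha, map_singleton])
    obtain ⟨hxZ, hyZ, hlx, hly⟩ := IsPeak.map (L := l ∘ cubePoint) hZ
    refine ⟨cubePoint (Z.map t), ?_, ?_, hlx, hly⟩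
    · rw [hammingDist_cubePoint, hxZ]
    · rw [hammingDist_comm, hammingDist_cubePoint, hyZ]

theorem exists_isPeakedDoubling {β : Type*} [LinearOrder β] (m : ℕ) :
    ∃ n, ∀ l : (Fin n → Bool) → β, Function.Injective l →
      ∃ ι : (Fin m → Bool) → Fin n → Bool, IsPeakedDoubling l ι := by
  obtain ⟨n, hn⟩ := exists_isPositionInvariant (β := β) (3 * m + 1) (2 * (3 * m + 1))
  refine ⟨n, fun l hl => ?_⟩
  obtain ⟨t, C, hC⟩ := hn fun z => l (cubePoint z)
  have embed (N : ℕ) (hN : N ≤ 3 * m + 1) : ∃ s : Fin N ×ₗ Bool ↪ Fin n,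
      IsPositionInvariant (fun z => l (cubePoint (z.map s))) (3 * m + 1) C := by
    have s : Fin N ×ₗ Bool ↪o Fin (2 * (3 * m + 1)) :=
      (Fintype.orderIsoFinOfCardEq _ rfl).symm.toOrderEmbedding.trans (Fin.castLEOrderEmb (by
        rw [Fintype.card_lex, Fintype.card_prod, Fintype.card_fin, Fintype.card_bool]
        omega))
    exact ⟨s.toEmbedding.trans t.toEmbedding, by simpa only [map_map] using hC.comp_map s⟩
  rcases exists_embedding_notMem_or_consecutive_mem C m with ⟨σ, hσ⟩ | ⟨σ, hσ⟩
  · obtain ⟨s, hs⟩ := embed (3 * m + 1) le_rfl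
    exact ⟨_, isPeakedDoubling_of_isPeak σ s fun a A B h =>
      ⟨_, hs.isPeak_inter (hl.comp (cubePoint_injective.comp (map_injective s))) (hσ a) h⟩⟩
  · obtain ⟨s, hs⟩ := embed (3 * m) (Nat.le_succ _)
    exact ⟨_, isPeakedDoubling_of_isPeak σ s fun a A B h =>
      ⟨_, hs.isPeak_union (hσ a).1 (hσ a).2 h⟩⟩

end Peak

section HammingWalk

variable {ι : Type*} {α : ι → Type*} [Fintype ι] [∀ i, DecidableEq (α i)] {N : ℕ}
  {w : ℕ → ∀ i, α i}

theorem hammingDist_le_of_forall_hammingDist_succ_le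
    (hw : ∀ i < N, hammingDist (w i) (w (i + 1)) ≤ 1) {a b : ℕ} (hab : a ≤ b) (hb : b ≤ N) :
    hammingDist (w a) (w b) ≤ b - a := by
  induction b, hab using Nat.le_induction with
  | base => simp
  | succ b hab ih =>
    have hprefix := ih (by omega)
    have hstep := hw b (by omega)
    have htriangle := hammingDist_triangle (w a) (w b) (w (b + 1))
    omega

theorem hammingDist_eq_dist_of_hammingDist_ends
    (hw : ∀ i < N, hammingDist (w i) (w (i + 1)) ≤ 1) (hN : hammingDist (w 0) (w N) = N)
    {a b : ℕ} (ha : a ≤ N) (hb : b ≤ N) : hammingDist (w a) (w b) = Nat.dist a b := by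
  wlog hab : a ≤ b generalizing a b
  · rw [hammingDist_comm, Nat.dist_comm]
    exact this hb ha (by omega)
  rw [Nat.dist_eq_sub_of_le hab]
  have hleft := hammingDist_le_of_forall_hammingDist_succ_le hw (Nat.zero_le a) ha
  have hmiddle := hammingDist_le_of_forall_hammingDist_succ_le hw hab hb
  have hright := hammingDist_le_of_forall_hammingDist_succ_le hw hb le_rfl
  have htriangle := hammingDist_triangle (w 0) (w a) (w N)
  have htriangle' := hammingDist_triangle (w a) (w b) (w N)
  omega

end HammingWalk

section Gcd

theorem gcd_le_left_of_not_dvd {a m : ℕ} (h : ¬ m ∣ a) : Nat.gcd a m ≤ a :=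
  Nat.gcd_le_left m (Nat.pos_of_ne_zero (by rintro rfl; exact h (dvd_zero m)))

theorem gcd_two_mul_add_one_two_pow (a r : ℕ) : Nat.gcd (2 * a + 1) (2 ^ r) = 1 :=
  Nat.Coprime.pow_right r (Nat.coprime_two_right.2 (odd_two_mul_add_one a))

theorem gcd_two_mul_two_pow_succ (a r : ℕ) :
    Nat.gcd (2 * a) (2 ^ (r + 1)) = 2 * Nat.gcd a (2 ^ r) := by
  rw [pow_succ', Nat.gcd_mul_left]

theorem gcd_two_pow_eq_of_mod {a r i : ℕ} (hi : i ≤ r) (hdvd : a % 2 ^ i = 0)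
    (hndvd : a % 2 ^ (i + 1) ≠ 0) : Nat.gcd a (2 ^ r) = 2 ^ i := by
  obtain ⟨e, -, hgcd⟩ := (Nat.dvd_prime_pow Nat.prime_two).1 (Nat.gcd_dvd_right a (2 ^ r))
  have hie : i ≤ e := (Nat.pow_dvd_pow_iff_le_right one_lt_two).1
    (hgcd ▸ Nat.dvd_gcd (Nat.dvd_of_mod_eq_zero hdvd) (pow_dvd_pow 2 hi))
  have hei : ¬ i + 1 ≤ e := fun h => hndvd (Nat.mod_eq_zero_of_dvd
    ((pow_dvd_pow 2 h).trans (hgcd ▸ Nat.gcd_dvd_left a (2 ^ r))))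
  rw [hgcd, show e = i by omega]

theorem gcd_two_pow_le_dist {a c r : ℕ} (hac : a ≠ c)
    (hdist : Nat.dist a c < Nat.gcd a (2 ^ r)) : Nat.gcd c (2 ^ r) ≤ Nat.dist a c := by
  have hpos : 0 < Nat.dist a c := Nat.dist_pos_of_ne hac
  have le_of_dvd {g : ℕ} (ha : g ∣ a) (hc : g ∣ c) : g ≤ Nat.dist a c :=
    Nat.le_of_dvd hpos (Nat.dvd_add (Nat.dvd_sub ha hc) (Nat.dvd_sub hc ha))
  obtain ⟨i, -, hi⟩ := (Nat.dvd_prime_pow Nat.prime_two).1 (Nat.gcd_dvd_right a (2 ^ r))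
  obtain ⟨j, -, hj⟩ := (Nat.dvd_prime_pow Nat.prime_two).1 (Nat.gcd_dvd_right c (2 ^ r))
  have ha : 2 ^ i ∣ a := hi ▸ Nat.gcd_dvd_left a (2 ^ r)
  have hc : 2 ^ j ∣ c := hj ▸ Nat.gcd_dvd_left c (2 ^ r)
  rcases le_total i j with hij | hji
  · exact absurd (le_of_dvd ha ((pow_dvd_pow 2 hij).trans hc)) (not_le.2 (hi ▸ hdist))
  · exact hj ▸ le_of_dvd ((pow_dvd_pow 2 hji).trans ha) hc

end Gcd

section ZigZagWalk

/-- The sequence that alternates between two sequences, starting with the first one. -/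
def interleave {α : Type*} (u v : ℕ → α) (i : ℕ) : α := if Even i then u (i / 2) else v (i / 2)

theorem interleave_two_mul {α : Type*} (u v : ℕ → α) (i : ℕ) : interleave u v (2 * i) = u i := by
  rw [interleave, if_pos (even_two_mul i), Nat.mul_div_cancel_left i two_pos]

theorem interleave_two_mul_add_one {α : Type*} (u v : ℕ → α) (i : ℕ) :
    interleave u v (2 * i + 1) = v i := by
  rw [interleave, if_neg (Nat.not_even_two_mul_add_one i), show (2 * i + 1) / 2 = i by omega]

/-- The first `2 ^ r` steps of `w` follow edges of the hypercube, lead to a vertex at distance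
`2 ^ r`, and are zig-zag with respect to the labelling `l`. The parents of the position `a` are
those at distance `gcd a (2 ^ r)` from it; only `0` and `2 ^ r` have none. -/
structure IsZigZagWalk {n : ℕ} {β : Type*} [LT β] (r : ℕ) (l : (Fin n → Bool) → β)
    (w : ℕ → Fin n → Bool) : Prop where
  hammingDist_succ : ∀ a < 2 ^ r, hammingDist (w a) (w (a + 1)) = 1
  hammingDist_ends : hammingDist (w 0) (w (2 ^ r)) = 2 ^ r
  label_lt : ∀ a ≤ 2 ^ r, ∀ b ≤ 2 ^ r, ¬ 2 ^ r ∣ a → Nat.dist a b = Nat.gcd a (2 ^ r) →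
    l (w b) < l (w a)

theorem isZigZagWalk_zero {β : Type*} [LT β] (l : (Fin 1 → Bool) → β) :
    IsZigZagWalk 0 l fun i _ => decide (i ≠ 0) where
  hammingDist_succ a ha := by
    obtain rfl : a = 0 := Nat.lt_one_iff.1 ha
    decide
  hammingDist_ends := by decide
  label_lt a _ _ _ ha := absurd (one_dvd a) ha

theorem IsPeakedDoubling.exists_isZigZagWalk {m n r : ℕ} {β : Type*} [LT β]
    {l : (Fin n → Bool) → β} {ι : (Fin m → Bool) → Fin n → Bool} (hι : IsPeakedDoubling l ι)
    {u : ℕ → Fin m → Bool} (hu : IsZigZagWalk r (l ∘ ι) u) : ∃ w, IsZigZagWalk (r + 1) l w := by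
  choose! v hleft hright hlabel_left hlabel_right using
    fun a (ha : a < 2 ^ r) => hι.exists_peak _ _ (hu.hammingDist_succ a ha)
  have hpow : 2 ^ (r + 1) = 2 * 2 ^ r := pow_succ' 2 r
  have even := interleave_two_mul (ι ∘ u) v
  have odd := interleave_two_mul_add_one (ι ∘ u) v
  refine ⟨interleave (ι ∘ u) v, fun a ha => ?_, ?_, fun a ha b hb hndvd hdist => ?_⟩
  · obtain ⟨i, rfl | rfl⟩ := Nat.even_or_odd' a
    · rw [even, odd]
      exact hleft i (by omega)
    · rw [odd, show 2 * i + 1 + 1 = 2 * (i + 1) by ring, even]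
      exact hright i (by omega)
  · rw [hpow, even, ← mul_zero 2, even, Function.comp_apply, Function.comp_apply,
      hι.hammingDist_map, hu.hammingDist_ends]
  · obtain ⟨i, rfl | rfl⟩ := Nat.even_or_odd' a
    · rw [gcd_two_mul_two_pow_succ, Nat.dist] at hdist
      obtain ⟨j, rfl⟩ : 2 ∣ b := by omega
      rw [even, even]
      refine hu.label_lt i (by omega) j (by omega) (fun h => hndvd ?_) (by rw [Nat.dist]; omega)
      exact hpow ▸ mul_dvd_mul_left 2 h
    · rw [gcd_two_mul_add_one_two_pow, Nat.dist] at hdist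
      have hb : b = 2 * i ∨ b = 2 * (i + 1) := by omega
      rcases hb with rfl | rfl <;> rw [odd, even]
      exacts [hlabel_left i (by omega), hlabel_right i (by omega)]

theorem exists_isZigZagWalk {β : Type*} [LinearOrder β] (r : ℕ) :
    ∃ n, ∀ l : (Fin n → Bool) → β, Function.Injective l → ∃ w, IsZigZagWalk r l w := by
  induction r with
  | zero => exact ⟨1, fun l _ => ⟨_, isZigZagWalk_zero l⟩⟩
  | succ r ih =>
    obtain ⟨m, hm⟩ := ih
    obtain ⟨n, hn⟩ := exists_isPeakedDoubling (β := β) m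
    refine ⟨n, fun l hl => ?_⟩
    obtain ⟨ι, hι⟩ := hn l hl
    obtain ⟨u, hu⟩ := hm (l ∘ ι) (hl.comp hι.injective)
    exact hι.exists_isZigZagWalk hu

namespace IsZigZagWalk

variable {n r : ℕ} {β : Type*} {w : ℕ → Fin n → Bool}

theorem hammingDist_eq_dist [LT β] {l : (Fin n → Bool) → β} (hw : IsZigZagWalk r l w) {a b : ℕ}
    (ha : a ≤ 2 ^ r) (hb : b ≤ 2 ^ r) : hammingDist (w a) (w b) = Nat.dist a b :=
  hammingDist_eq_dist_of_hammingDist_ends (fun i hi => (hw.hammingDist_succ i hi).le)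
    hw.hammingDist_ends ha hb

theorem isIsometricPath [LT β] {l : (Fin n → Bool) → β} (hw : IsZigZagWalk r l w) :
    IsIsometricPath fun a : Fin (2 ^ r + 1) => w a :=
  fun a b => hw.hammingDist_eq_dist a.is_le b.is_le

theorem isZigZag {l : (Fin n → Bool) → ℕ} (hw : IsZigZagWalk r l w) :
    IsZigZag fun a : Fin (2 ^ r + 1) => l (w a) := by
  intro j hj hjr a hmod hmod' b hdist
  refine hw.label_lt a a.is_le b b.is_le (fun h => hmod' ?_) ?_
  · exact Nat.mod_eq_zero_of_dvd ((pow_dvd_pow 2 (by omega)).trans h)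
  · rw [hdist, gcd_two_pow_eq_of_mod (Nat.sub_le r j) hmod hmod']

/-- Moving from `c` to its parent on the side of `a`, which is not beyond `a`, leads closer to `a`
and to an earlier label. -/
theorem label_lt_of_dist_lt [Preorder β] {l : (Fin n → Bool) → β} (hw : IsZigZagWalk r l w)
    {a c : ℕ} (ha : a ≤ 2 ^ r) (hc : c ≤ 2 ^ r) (hac : a ≠ c)
    (hdist : Nat.dist a c < Nat.gcd a (2 ^ r)) : l (w a) < l (w c) := by
  induction hd : Nat.dist a c using Nat.strong_induction_on generalizing c with
  | _ d ih =>
    have hpos : 0 < Nat.gcd c (2 ^ r) := Nat.gcd_pos_of_pos_right c (by positivity)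
    have hle : Nat.gcd c (2 ^ r) ≤ Nat.dist a c := gcd_two_pow_le_dist hac hdist
    have hndvd : ¬ 2 ^ r ∣ c := fun h => by
      have hgcd : Nat.gcd a (2 ^ r) ≤ 2 ^ r := Nat.gcd_le_right a (by positivity)
      rw [Nat.gcd_eq_right h] at hle
      omega
    obtain ⟨b, hb, hcb, hab⟩ : ∃ b ≤ 2 ^ r, Nat.dist c b = Nat.gcd c (2 ^ r) ∧
        Nat.dist a b = Nat.dist a c - Nat.gcd c (2 ^ r) := by
      simp only [Nat.dist] at hle ⊢
      rcases hac.lt_or_gt with hlt | hlt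
      · exact ⟨c - Nat.gcd c (2 ^ r), by omega, by omega, by omega⟩
      · exact ⟨c + Nat.gcd c (2 ^ r), by omega, by omega, by omega⟩
    have hparent : l (w b) < l (w c) := hw.label_lt c hc b hb hndvd hcb
    rcases eq_or_ne a b with rfl | hne
    · exact hparent
    · exact (ih _ (by omega) hb hne (by omega) rfl).trans hparent

end IsZigZagWalk

end ZigZagWalk

section GcdSum

open Finset

theorem sum_range_two_mul {M : Type*} [AddCommMonoid M] (f : ℕ → M) (n : ℕ) :
    ∑ a ∈ range (2 * n), f a = ∑ a ∈ range n, f (2 * a) + ∑ a ∈ range n, f (2 * a + 1) := by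
  induction n with
  | zero => simp
  | succ n ih =>
    rw [show 2 * (n + 1) = 2 * n + 1 + 1 by ring]
    simp only [sum_range_succ, ih]
    abel

theorem two_mul_sum_range_gcd_two_pow (r : ℕ) :
    2 * ∑ a ∈ range (2 ^ r), Nat.gcd a (2 ^ r) = 2 ^ r * (r + 2) := by
  induction r with
  | zero => simp
  | succ r ih =>
    rw [show range (2 ^ (r + 1)) = range (2 * 2 ^ r) by rw [pow_succ'], sum_range_two_mul]
    simp only [gcd_two_mul_two_pow_succ, gcd_two_mul_add_one_two_pow, ← mul_sum, sum_const,
      card_range, smul_eq_mul]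
    linear_combination 2 * ih

theorem le_four_mul_sum_range_gcd_two_pow {r k : ℕ} (hk : 2 ^ r < 2 * k) :
    2 ^ r * (r + 1) ≤ 4 * ∑ a ∈ range k, Nat.gcd a (2 ^ r) := by
  cases r with
  | zero =>
    simp only [pow_zero, Nat.gcd_one_right, sum_const, card_range, smul_eq_mul] at hk ⊢
    omega
  | succ s =>
    have hs : range (2 ^ s) ⊆ range k := range_mono (by rw [pow_succ] at hk; omega)
    calc 2 ^ (s + 1) * (s + 1 + 1)
      _ = 4 * ∑ a ∈ range (2 ^ s), Nat.gcd a (2 ^ s) := by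
        rw [pow_succ']
        linarith [two_mul_sum_range_gcd_two_pow s]
      _ ≤ 4 * ∑ a ∈ range (2 ^ s), Nat.gcd a (2 ^ (s + 1)) := by
        gcongr with a
        exact Nat.le_of_dvd (Nat.gcd_pos_of_pos_right a (by positivity))
          (Nat.gcd_dvd_gcd_of_dvd_right a (pow_dvd_pow 2 s.le_succ))
      _ ≤ 4 * ∑ a ∈ range k, Nat.gcd a (2 ^ (s + 1)) := by
        gcongr

end GcdSum

section CostSharing

variable {V : Type*}

theorem GWSP.IsOrdered.toProtocol_apply [DecidableEq V] {Ξ : GWSP V} (hΞ : Ξ.IsOrdered)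
    (N : Network V) (e : Sym2 V) {R : Finset V} {i : V} (hi : i ∈ R) :
    Ξ.toProtocol N e R i = if ∀ j ∈ R, Ξ.rank i ≤ Ξ.rank j then N.cost e else 0 := by
  by_cases hfirst : ∀ j ∈ R, Ξ.rank i ≤ Ξ.rank j
  · have hblock : Ξ.firstBlock R = {i} := by
      refine Finset.eq_singleton_iff_unique_mem.2 ⟨Finset.mem_filter.2 ⟨hi, hfirst⟩, fun j hj => ?_⟩
      obtain ⟨hjR, hjle⟩ := Finset.mem_filter.1 hj
      exact hΞ (le_antisymm (hjle i hi) (hfirst j hjR))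
    rw [if_pos hfirst, GWSP.toProtocol, hblock, Finset.sum_singleton,
      div_self (Ξ.weight_pos i).ne', one_mul, if_pos (Finset.mem_singleton_self i)]
  · have hblock : i ∉ Ξ.firstBlock R := fun h => hfirst (Finset.mem_filter.1 h).2
    rw [if_neg hfirst, GWSP.toProtocol, if_neg hblock]

theorem exists_walk_sum_le {G : SimpleGraph V} {c w : Sym2 V → ℝ} {A : V → Prop} {u v : V}
    (q : G.Walk u v) (hv : A v) (hw : ∀ e ∈ q.edges, 0 ≤ w e)
    (hcw : ∀ e ∈ q.edges, c e ≤ w e ∨ ∀ x ∈ e, A x) :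
    ∃ y, A y ∧ ∃ q' : G.Walk u y, (q'.edges.map c).sum ≤ (q.edges.map w).sum := by
  induction q with
  | nil => exact ⟨_, hv, .nil, by simp⟩
  | @cons u x v hux q ih =>
    simp only [SimpleGraph.Walk.edges_cons, List.forall_mem_cons, List.map_cons,
      List.sum_cons] at hw hcw ⊢
    rcases hcw.1 with hle | hends
    · obtain ⟨y, hy, q', hq'⟩ := ih hv hw.2 hcw.2
      exact ⟨y, hy, .cons hux q', by simpa using add_le_add hle hq'⟩
    · refine ⟨u, hends u (Sym2.mem_mk_left u x), .nil, ?_⟩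
      have : 0 ≤ (q.edges.map w).sum := List.sum_nonneg (by simpa using hw.2)
      simpa using add_nonneg hw.1 this

theorem sub_le_sum_edges {G : SimpleGraph V} {f : V → ℝ} {c : Sym2 V → ℝ}
    (hf : ∀ x y, G.Adj x y → f y - f x ≤ c s(x, y)) {u v : V} (q : G.Walk u v) :
    f v - f u ≤ (q.edges.map c).sum := by
  induction q with
  | nil => simp
  | @cons u x v hux q ih =>
    have hstep := hf u x hux
    rw [SimpleGraph.Walk.edges_cons, List.map_cons, List.sum_cons]
    linarith

namespace Network

variable {N : Network V} {S : Finset V}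

theorem cost_nonneg_of_mem_edges {u v : V} {q : N.graph.Walk u v} {e : Sym2 V}
    (he : e ∈ q.edges) : 0 ≤ N.cost e :=
  N.cost_nonneg e (q.edges_subset_edgeSet he)

instance : Nonempty (N.Profile S) := by
  classical exact ⟨fun i => (N.connected i N.root).some.toPath⟩

variable [DecidableEq V]

theorem mem_users {P : N.Profile S} {e : Sym2 V} {i : S} :
    (i : V) ∈ N.users P e ↔ e ∈ (P i).1.edges := by
  simp [users]

theorem mem_of_mem_users {P : N.Profile S} {e : Sym2 V} {x : V} (hx : x ∈ N.users P e) : x ∈ S := by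
  obtain ⟨i, -, rfl⟩ := Finset.mem_map.1 hx
  exact i.2

theorem sum_edges_le_socialCost (P : N.Profile S) (i : S) :
    ((P i).1.edges.map N.cost).sum ≤ N.socialCost P := by
  rw [← List.sum_toFinset _ (P i).2.isTrail.edges_nodup]
  refine Finset.sum_le_sum_of_subset_of_nonneg
    (Finset.subset_biUnion_of_mem (fun i : S => (P i).1.edges.toFinset) (Finset.mem_univ i))
    fun e he _ => ?_
  obtain ⟨j, -, hj⟩ := Finset.mem_biUnion.1 he
  exact cost_nonneg_of_mem_edges (List.mem_toFinset.1 hj)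

theorem socialCost_nonneg (P : N.Profile S) : 0 ≤ N.socialCost P := by
  refine Finset.sum_nonneg fun e he => ?_
  obtain ⟨j, -, hj⟩ := Finset.mem_biUnion.1 he
  exact cost_nonneg_of_mem_edges (List.mem_toFinset.1 hj)

theorem opt_le_socialCost (P : N.Profile S) : N.opt S ≤ N.socialCost P :=
  ciInf_le ⟨0, Set.forall_mem_range.2 socialCost_nonneg⟩ P

theorem ofReal_socialCost_div_opt_le_priceOfAnarchy {ξ : CostSharingProtocol V} {P : N.Profile S}
    (hP : N.IsNash ξ P) (hopt : 0 < N.opt S) :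
    ENNReal.ofReal (N.socialCost P / N.opt S) ≤ N.priceOfAnarchy ξ S := by
  rw [ENNReal.ofReal_div_of_pos hopt]
  exact le_iSup (fun P : {P : N.Profile S // N.IsNash ξ P} =>
    ENNReal.ofReal (N.socialCost P.1) / ENNReal.ofReal (N.opt S)) ⟨P, hP⟩

end Network

/-- The map `par` makes `S` and the root into a tree: every `x ∈ S` is adjacent to its parent
`par x`, which is the root or a vertex of `S` at which the height `κ` is smaller. -/
structure IsParentMap (N : Network V) (S : Finset V) (par : V → V) (κ : V → ℕ) : Prop where
  root_notMem : N.root ∉ S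
  adj : ∀ x ∈ S, N.graph.Adj x (par x)
  parent : ∀ x ∈ S, par x = N.root ∨ par x ∈ S ∧ κ (par x) < κ x

/-- Every player follows the parents given by `par` to the root: the path of `x` contains the edge
from `x` to its parent, and all its other edges join vertices of smaller height to their parents. -/
structure IsTreeProfile {N : Network V} {S : Finset V} (par : V → V) (κ : V → ℕ)
    (P : N.Profile S) : Prop where
  parentEdge_mem : ∀ x : S, s(↑x, par x) ∈ (P x).1.edges
  eq_parentEdge : ∀ x : S, ∀ e ∈ (P x).1.edges, ∃ y ∈ S, (y = ↑x ∨ κ y < κ x) ∧ e = s(y, par y)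

namespace IsParentMap

variable {N : Network V} {S : Finset V} {par : V → V} {κ : V → ℕ}

theorem injOn_parentEdge (h : IsParentMap N S par κ) : Set.InjOn (fun x => s(x, par x)) S := by
  have height_lt {x y : V} (hx : x ∈ S) (hy : y ∈ S) (hxy : par x = y) : κ y < κ x := by
    subst hxy
    exact ((h.parent x hx).resolve_left fun hroot => h.root_notMem (hroot ▸ hy)).2
  intro x hx y hy hxy
  rcases Sym2.eq_iff.1 hxy with ⟨hxy, -⟩ | ⟨hyx, hxy⟩
  · exact hxy
  · exact absurd (height_lt hx hy hxy) (height_lt hy hx hyx.symm).not_gt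

theorem notMem_support_of_forall_edges (h : IsParentMap N S par κ) {x z : V} (hx : x ∈ S)
    {q : N.graph.Walk z N.root}
    (hq : ∀ e ∈ q.edges, ∃ y ∈ S, κ y < κ x ∧ e = s(y, par y)) : x ∉ q.support := by
  rw [SimpleGraph.Walk.mem_support_iff_exists_mem_edges]
  rintro (rfl | ⟨e, he, hxe⟩)
  · exact h.root_notMem hx
  · obtain ⟨y, hy, hlt, rfl⟩ := hq e he
    rcases Sym2.mem_iff.1 hxe with rfl | rfl
    · exact lt_irrefl _ hlt
    · rcases h.parent y hy with hroot | ⟨-, hlt'⟩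
      · exact h.root_notMem (hroot ▸ hx)
      · exact lt_asymm hlt hlt'

theorem exists_isTreeProfile (h : IsParentMap N S par κ) :
    ∃ P : N.Profile S, IsTreeProfile par κ P := by
  suffices hpath : ∀ x : S, ∃ q : N.graph.Path (x : V) N.root, s(↑x, par x) ∈ q.1.edges ∧
      ∀ e ∈ q.1.edges, ∃ y ∈ S, (y = ↑x ∨ κ y < κ x) ∧ e = s(y, par y) by
    choose P hP hP' using hpath
    exact ⟨P, hP, hP'⟩
  rintro ⟨x, hx⟩
  induction hk : κ x using Nat.strong_induction_on generalizing x with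
  | _ k ih =>
    obtain ⟨q, hq⟩ : ∃ q : N.graph.Path (par x) N.root,
        ∀ e ∈ q.1.edges, ∃ y ∈ S, κ y < κ x ∧ e = s(y, par y) := by
      rcases h.parent x hx with hroot | ⟨hpar, hlt⟩
      · rw [hroot]
        exact ⟨.nil, by simp [SimpleGraph.Path.nil]⟩
      · obtain ⟨q, -, hq⟩ := ih _ (hk ▸ hlt) (par x) hpar rfl
        refine ⟨q, fun e he => ?_⟩
        obtain ⟨y, hy, hyx, rfl⟩ := hq e he
        exact ⟨y, hy, hyx.elim (fun heq => heq ▸ hlt) hlt.trans', rfl⟩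
    refine ⟨⟨.cons (h.adj x hx) q.1, q.2.cons (h.notMem_support_of_forall_edges hx hq)⟩, by simp,
      fun e he => ?_⟩
    rcases List.mem_cons.1 ((SimpleGraph.Walk.edges_cons (h.adj x hx) q.1) ▸ he) with rfl | he
    · exact ⟨x, hx, Or.inl rfl, rfl⟩
    · obtain ⟨y, hy, hlt, rfl⟩ := hq e he
      exact ⟨y, hy, Or.inr (hk ▸ hlt), rfl⟩

end IsParentMap

namespace IsTreeProfile

variable {N : Network V} {S : Finset V} {par : V → V} {Ξ : GWSP V} {P : N.Profile S}

theorem forall_mem_of_mem_edges (hP : IsTreeProfile par Ξ.rank P)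
    (h : IsParentMap N S par Ξ.rank) {x : V} {y : S} (hyx : Ξ.rank y < Ξ.rank x) {e : Sym2 V}
    (he : e ∈ (P y).1.edges) : ∀ z ∈ e, z = N.root ∨ z ∈ S ∧ Ξ.rank z < Ξ.rank x := by
  obtain ⟨z, hz, hzy, rfl⟩ := hP.eq_parentEdge y e he
  have hzx : Ξ.rank z < Ξ.rank x := hzy.elim (fun heq => heq ▸ hyx) hyx.trans'
  intro v hv
  rcases Sym2.mem_iff.1 hv with rfl | rfl
  · exact Or.inr ⟨hz, hzx⟩
  · exact (h.parent z hz).imp_right fun ⟨hpar, hlt⟩ => ⟨hpar, hlt.trans hzx⟩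

variable [DecidableEq V]

theorem socialCost_eq {κ : V → ℕ} (hP : IsTreeProfile par κ P)
    (h : IsParentMap N S par κ) : N.socialCost P = ∑ x ∈ S, N.cost s(x, par x) := by
  have hused : (Finset.univ.biUnion fun i : S => (P i).1.edges.toFinset) =
      S.image fun x => s(x, par x) := by
    ext e
    simp only [Finset.mem_biUnion, Finset.mem_univ, true_and, List.mem_toFinset, Finset.mem_image]
    constructor
    · rintro ⟨i, hi⟩
      obtain ⟨y, hy, -, rfl⟩ := hP.eq_parentEdge i e hi
      exact ⟨y, hy, rfl⟩
    · rintro ⟨x, hx, rfl⟩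
      exact ⟨⟨x, hx⟩, hP.parentEdge_mem ⟨x, hx⟩⟩
  rw [Network.socialCost, hused, Finset.sum_image h.injOn_parentEdge]

theorem playerCost_le (hΞ : Ξ.IsOrdered) (hP : IsTreeProfile par Ξ.rank P) (x : S) :
    N.playerCost (Ξ.toProtocol N) P x ≤ N.cost s(↑x, par x) := by
  have share {e : Sym2 V} (he : e ∈ (P x).1.edges) :=
    hΞ.toProtocol_apply N e (Network.mem_users.2 he)
  have hmem := hP.parentEdge_mem x
  rw [Network.playerCost, Finset.sum_eq_single_of_mem _ (List.mem_toFinset.2 hmem), share hmem]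
  · split_ifs
    exacts [le_rfl, Network.cost_nonneg_of_mem_edges hmem]
  · intro e he hne
    have he := List.mem_toFinset.1 he
    obtain ⟨y, hy, rfl | hlt, rfl⟩ := hP.eq_parentEdge x e he
    · exact absurd rfl hne
    · have hyuser := Network.mem_users.2 (hP.parentEdge_mem ⟨y, hy⟩)
      rw [share he, if_neg fun hfirst => (hfirst y hyuser).not_gt hlt]

/-- A deviating player pays in full until she meets the tree of her predecessors. -/
theorem exists_walk_sum_le_playerCost (hΞ : Ξ.IsOrdered) (hP : IsTreeProfile par Ξ.rank P)
    (h : IsParentMap N S par Ξ.rank) (x : S) (p : N.graph.Path (x : V) N.root) :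
    ∃ y, (y = N.root ∨ y ∈ S ∧ Ξ.rank y < Ξ.rank x) ∧ ∃ q : N.graph.Walk x y,
      (q.edges.map N.cost).sum ≤ N.playerCost (Ξ.toProtocol N) (Function.update P x p) x := by
  set Q : N.Profile S := Function.update P x p
  have hQx : Q x = p := Function.update_self ..
  have share {e : Sym2 V} (he : e ∈ p.1.edges) :=
    hΞ.toProtocol_apply N e (Network.mem_users.2 (hQx ▸ he))
  rw [Network.playerCost, hQx, List.sum_toFinset _ p.2.isTrail.edges_nodup]
  refine exists_walk_sum_le p.1 (Or.inl rfl) (fun e he => ?_) fun e he => ?_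
  · rw [share he]
    split_ifs
    exacts [Network.cost_nonneg_of_mem_edges he, le_rfl]
  · rw [share he]
    split_ifs with hfirst
    · exact Or.inl le_rfl
    · push Not at hfirst
      obtain ⟨j, hj, hjx⟩ := hfirst
      lift j to S using Network.mem_of_mem_users hj
      have hne : j ≠ x := fun heq => (heq ▸ hjx).false
      rw [Network.mem_users, show Q j = P j from Function.update_of_ne hne ..] at hj
      exact Or.inr (hP.forall_mem_of_mem_edges h hjx hj)

theorem isNash (hΞ : Ξ.IsOrdered) (hP : IsTreeProfile par Ξ.rank P)
    (h : IsParentMap N S par Ξ.rank)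
    (hdetour : ∀ x ∈ S, ∀ y, (y = N.root ∨ y ∈ S ∧ Ξ.rank y < Ξ.rank x) →
      ∀ q : N.graph.Walk x y, N.cost s(x, par x) ≤ (q.edges.map N.cost).sum) :
    N.IsNash (Ξ.toProtocol N) P := by
  intro x p
  obtain ⟨y, hy, q, hq⟩ := hP.exists_walk_sum_le_playerCost hΞ h x p
  exact ((hP.playerCost_le hΞ x).trans (hdetour x x.2 y hy q)).trans hq

end IsTreeProfile

end CostSharing

section RootedHypercube

variable {n : ℕ} {ρ : ℝ≥0}

/-- The hypercube distance from `x`, truncated at `ρ`, the root being at distance `ρ`. It serves as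
a potential: it grows by at most the cost along every edge. -/
noncomputable def truncatedDist (ρ : ℝ≥0) (x : Fin n → Bool) : Option (Fin n → Bool) → ℝ
  | none => ρ
  | some y => min ρ (hammingDist x y)

theorem truncatedDist_sub_le_cost (x : Fin n → Bool) (y z : Option (Fin n → Bool)) :
    truncatedDist ρ x z - truncatedDist ρ x y ≤ (rootedHypercube n ρ).cost s(y, z) := by
  have hρ : (0 : ℝ) ≤ ρ := ρ.2
  have hnonneg (y) : 0 ≤ truncatedDist ρ x y := by
    cases y
    exacts [hρ, le_min hρ (Nat.cast_nonneg _)]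
  have hle (y) : truncatedDist ρ x y ≤ ρ := by
    cases y
    exacts [le_rfl, min_le_left _ _]
  match y, z with
  | none, z => exact (sub_le_self _ (hnonneg none)).trans (hle z)
  | some y, none => exact sub_le_self _ (hnonneg (some y))
  | some y, some z =>
    have htriangle : (hammingDist x z : ℝ) ≤ hammingDist x y + hammingDist y z :=
      mod_cast hammingDist_triangle x y z
    have hdist : (0 : ℝ) ≤ hammingDist y z := Nat.cast_nonneg _
    change min (ρ : ℝ) (hammingDist x z) - min (ρ : ℝ) (hammingDist x y) ≤ (hammingDist y z : ℝ)
    rw [sub_le_iff_le_add', ← min_add_add_right]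
    exact min_le_min (le_add_of_nonneg_right hdist) htriangle

theorem truncatedDist_le_sum_edges {x : Fin n → Bool} {z : Option (Fin n → Bool)}
    (q : (rootedHypercube n ρ).graph.Walk (some x) z) :
    truncatedDist ρ x z ≤ (q.edges.map (rootedHypercube n ρ).cost).sum := by
  have hself : truncatedDist ρ x (some x) = 0 := by simp [truncatedDist]
  simpa only [hself, sub_zero] using
    sub_le_sum_edges (fun y z _ => truncatedDist_sub_le_cost (ρ := ρ) x y z) q

theorem le_opt_rootedHypercube {S : Finset (Option (Fin n → Bool))} {x : Fin n → Bool}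
    (hx : some x ∈ S) : ρ ≤ (rootedHypercube n ρ).opt S :=
  le_ciInf fun P => (truncatedDist_le_sum_edges (P ⟨some x, hx⟩).1).trans
    (Network.sum_edges_le_socialCost P _)

/-- The first `k` vertices of a sequence in the hypercube, as vertices of the rooted hypercube. -/
def initialSegment (w : ℕ → Fin n → Bool) (k : ℕ) : Finset (Option (Fin n → Bool)) :=
  Finset.univ.image fun a : Fin k => some (w a)

/-- The parent map that joins `w a` to `w b` if `up a = some b`, and to the root if `up a = none`.
The index `a` is read off as the distance from `w 0`, as is correct for isometric `w`. -/
def sequenceParent (w : ℕ → Fin n → Bool) (up : ℕ → Option ℕ) (z : Option (Fin n → Bool)) :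
    Option (Fin n → Bool) :=
  z.bind fun x => (up (hammingDist (w 0) x)).map w

variable {w : ℕ → Fin n → Bool} {k : ℕ}

theorem mem_initialSegment {z : Option (Fin n → Bool)} :
    z ∈ initialSegment w k ↔ ∃ a < k, some (w a) = z := by
  simp [initialSegment, Fin.exists_iff]

theorem root_notMem_initialSegment : (rootedHypercube n ρ).root ∉ initialSegment w k := by
  rw [mem_initialSegment]
  rintro ⟨a, -, ha⟩
  exact Option.some_ne_none _ ha

section Isometric

variable (hw : ∀ a < k, ∀ b < k, hammingDist (w a) (w b) = Nat.dist a b)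

include hw

theorem injective_some_comp_of_isometric : Function.Injective fun a : Fin k => some (w a) := by
  intro a b hab
  have hdist := hw a a.2 b b.2
  rw [Option.some_inj.1 hab, hammingDist_self] at hdist
  exact Fin.ext (Nat.eq_of_dist_eq_zero hdist.symm)

theorem card_initialSegment : (initialSegment w k).card = k := by
  rw [initialSegment, Finset.card_image_of_injective _ (injective_some_comp_of_isometric hw),
    Finset.card_fin]

theorem sum_initialSegment (f : Option (Fin n → Bool) → ℝ) :
    ∑ z ∈ initialSegment w k, f z = ∑ a ∈ Finset.range k, f (some (w a)) := by
  rw [initialSegment, Finset.sum_image (injective_some_comp_of_isometric hw).injOn,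
    Fin.sum_univ_eq_sum_range fun a => f (some (w a))]

theorem sequenceParent_some (up : ℕ → Option ℕ) {a : ℕ} (ha : a < k) :
    sequenceParent w up (some (w a)) = (up a).map w := by
  rw [sequenceParent, Option.bind_some, hw 0 (Nat.zero_lt_of_lt ha) a ha, Nat.dist_zero_left]

theorem isParentMap_sequenceParent {up : ℕ → Option ℕ} {κ : Option (Fin n → Bool) → ℕ}
    (hup : ∀ a < k, ∀ b ∈ up a, b < k ∧ κ (some (w b)) < κ (some (w a))) :
    IsParentMap (rootedHypercube n ρ) (initialSegment w k) (sequenceParent w up) κ := by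
  have hparent : ∀ x ∈ initialSegment w k, sequenceParent w up x = none ∨
      sequenceParent w up x ∈ initialSegment w k ∧ κ (sequenceParent w up x) < κ x := by
    intro x hx
    obtain ⟨a, ha, rfl⟩ := mem_initialSegment.1 hx
    rw [sequenceParent_some hw up ha]
    cases hb : up a with
    | none => exact Or.inl rfl
    | some b =>
      obtain ⟨hbk, hlt⟩ := hup a ha b hb
      exact Or.inr ⟨mem_initialSegment.2 ⟨b, hbk, rfl⟩, hlt⟩
  refine ⟨root_notMem_initialSegment, fun x hx hself => ?_, hparent⟩
  rcases hparent x hx with hroot | ⟨-, hlt⟩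
  · exact root_notMem_initialSegment (ρ := 0) (hself.trans hroot ▸ hx)
  · exact hlt.ne' (congrArg κ hself)

end Isometric

theorem opt_initialSegment_le
    (hw : ∀ a < k + 1, ∀ b < k + 1, hammingDist (w a) (w b) = Nat.dist a b) :
    (rootedHypercube n ρ).opt (initialSegment w (k + 1)) ≤ ρ + k := by
  let up (a : ℕ) : Option ℕ := if a = 0 then none else some (a - 1)
  let κ (z : Option (Fin n → Bool)) : ℕ := z.elim 0 (hammingDist (w 0))
  have hκ {a : ℕ} (ha : a < k + 1) : κ (some (w a)) = a :=
    (hw 0 k.succ_pos a ha).trans (Nat.dist_zero_left a)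
  have hpar : IsParentMap (rootedHypercube n ρ) (initialSegment w (k + 1))
      (sequenceParent w up) κ :=
    isParentMap_sequenceParent hw fun a ha b hb => by
      simp only [up, Option.mem_def, Option.ite_none_left_eq_some, Option.some_inj] at hb
      rw [hκ ha, hκ (by omega)]
      omega
  obtain ⟨P, hP⟩ := hpar.exists_isTreeProfile
  have hstep : ∀ a ∈ Finset.range k, (rootedHypercube n ρ).cost
      s(some (w (a + 1)), sequenceParent w up (some (w (a + 1)))) = 1 := by
    intro a ha
    have ha := Finset.mem_range.1 ha
    rw [sequenceParent_some hw up (by omega)]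
    change ((hammingDist (w (a + 1)) (w a) : ℕ) : ℝ) = 1
    rw [hw _ (by omega) _ (by omega), Nat.dist, Nat.cast_eq_one]
    omega
  refine (Network.opt_le_socialCost P).trans_eq ?_
  rw [hP.socialCost_eq hpar, sum_initialSegment hw, Finset.sum_range_succ',
    Finset.sum_congr rfl hstep, sequenceParent_some hw up k.succ_pos, Finset.sum_const,
    Finset.card_range, nsmul_one, add_comm]
  rfl

/-- The parent in the equilibrium along a zig-zag walk: the root for the positions `0` and `2 ^ r`,
and the smaller one of the two parents for the positions between them. -/
def zigZagParent (r a : ℕ) : Option ℕ :=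
  if 2 ^ r ∣ a then none else some (a - Nat.gcd a (2 ^ r))

namespace IsZigZagWalk

variable {r : ℕ}

theorem isParentMap {κ : Option (Fin n → Bool) → ℕ}
    (hw : IsZigZagWalk r (fun x => κ (some x)) w) (hk : k ≤ 2 ^ r + 1) :
    IsParentMap (rootedHypercube n ρ) (initialSegment w k)
      (sequenceParent w (zigZagParent r)) κ := by
  refine isParentMap_sequenceParent (fun a ha b hb => ?_) fun a ha b hb => ?_
  · exact hw.hammingDist_eq_dist (by omega) (by omega)
  · rw [zigZagParent, Option.mem_def, Option.ite_none_left_eq_some, Option.some_inj] at hb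
    obtain ⟨hndvd, rfl⟩ := hb
    have hle := gcd_le_left_of_not_dvd hndvd
    exact ⟨by omega, hw.label_lt a (by omega) _ (by omega) hndvd (by rw [Nat.dist]; omega)⟩

theorem cost_zigZagParent {l : (Fin n → Bool) → ℕ} (hw : IsZigZagWalk r l w) {a : ℕ}
    (ha : a < 2 ^ r + 1) :
    (rootedHypercube n (2 ^ r)).cost
      s(some (w a), sequenceParent w (zigZagParent r) (some (w a))) = Nat.gcd a (2 ^ r) := by
  have hiso : ∀ a < 2 ^ r + 1, ∀ b < 2 ^ r + 1, hammingDist (w a) (w b) = Nat.dist a b :=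
    fun a ha b hb => hw.hammingDist_eq_dist (by omega) (by omega)
  rw [sequenceParent_some hiso _ ha, zigZagParent]
  split_ifs with hdvd
  · rw [Nat.gcd_eq_right hdvd, Nat.cast_pow]
    rfl
  · have hle := gcd_le_left_of_not_dvd hdvd
    change ((hammingDist (w a) (w (a - Nat.gcd a (2 ^ r))) : ℕ) : ℝ) = _
    rw [hiso a ha _ (by omega), Nat.dist, Nat.cast_inj]
    omega

variable {Ξ : GWSP (Option (Fin n → Bool))}

theorem gcd_le_truncatedDist (hw : IsZigZagWalk r (fun x => Ξ.rank (some x)) w)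
    (hk : k ≤ 2 ^ r + 1) {a : ℕ} (ha : a < k) {z : Option (Fin n → Bool)}
    (hz : z = none ∨ z ∈ initialSegment w k ∧ Ξ.rank z < Ξ.rank (some (w a))) :
    Nat.gcd a (2 ^ r) ≤ truncatedDist (2 ^ r) (w a) z := by
  have hle : Nat.gcd a (2 ^ r) ≤ 2 ^ r := Nat.gcd_le_right a (by positivity)
  rcases hz with rfl | ⟨hz, hlt⟩
  · rw [truncatedDist]
    exact_mod_cast hle
  · obtain ⟨b, hb, rfl⟩ := mem_initialSegment.1 hz
    rw [truncatedDist, hw.hammingDist_eq_dist (by omega) (by omega)]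
    refine le_min (mod_cast hle) (Nat.cast_le.2 (not_lt.1 fun hdist => hlt.not_gt ?_))
    exact hw.label_lt_of_dist_lt (by omega) (by omega) (fun hab => (hab ▸ hlt).false) hdist

theorem exists_isNash (hΞ : Ξ.IsOrdered) (hw : IsZigZagWalk r (fun x => Ξ.rank (some x)) w)
    (hk : k ≤ 2 ^ r + 1) :
    ∃ P : (rootedHypercube n (2 ^ r)).Profile (initialSegment w k),
      (rootedHypercube n (2 ^ r)).IsNash (Ξ.toProtocol (rootedHypercube n (2 ^ r))) P ∧
      (rootedHypercube n (2 ^ r)).socialCost P = ∑ a ∈ Finset.range k, (Nat.gcd a (2 ^ r) : ℝ) := by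
  have hpar := hw.isParentMap (ρ := 2 ^ r) hk
  obtain ⟨P, hP⟩ := hpar.exists_isTreeProfile
  refine ⟨P, hP.isNash hΞ hpar fun x hx y hy q => ?_, ?_⟩
  · obtain ⟨a, ha, rfl⟩ := mem_initialSegment.1 hx
    rw [hw.cost_zigZagParent (ha.trans_le hk)]
    exact (hw.gcd_le_truncatedDist hk ha hy).trans (truncatedDist_le_sum_edges q)
  · rw [hP.socialCost_eq hpar, sum_initialSegment fun a ha b hb =>
      hw.hammingDist_eq_dist (by omega) (by omega)]
    exact Finset.sum_congr rfl fun a ha =>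
      hw.cost_zigZagParent ((Finset.mem_range.1 ha).trans_le hk)

theorem le_priceOfAnarchy (hΞ : Ξ.IsOrdered)
    (hw : IsZigZagWalk r (fun x => Ξ.rank (some x)) w) (hk : k ≤ 2 ^ r)
    (hrk : 2 ^ r < 2 * (k + 1)) :
    0 < (rootedHypercube n (2 ^ r)).opt (initialSegment w (k + 1)) ∧
      ENNReal.ofReal ((r + 1) / 8) ≤ (rootedHypercube n (2 ^ r)).priceOfAnarchy
        (Ξ.toProtocol (rootedHypercube n (2 ^ r))) (initialSegment w (k + 1)) := by
  obtain ⟨P, hP, hcost⟩ := hw.exists_isNash hΞ (Nat.add_le_add_right hk 1)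
  have hgcd : (2 : ℝ) ^ r * (r + 1) ≤ 4 * ∑ a ∈ Finset.range (k + 1), (Nat.gcd a (2 ^ r) : ℝ) :=
    mod_cast le_four_mul_sum_range_gcd_two_pow hrk
  have hopt_pos : 0 < (rootedHypercube n (2 ^ r)).opt (initialSegment w (k + 1)) := by
    have hmem : some (w 0) ∈ initialSegment w (k + 1) :=
      mem_initialSegment.2 ⟨0, k.succ_pos, rfl⟩
    exact lt_of_lt_of_le (by positivity) (le_opt_rootedHypercube hmem)
  have hopt_le : (rootedHypercube n (2 ^ r)).opt (initialSegment w (k + 1)) ≤ 2 * 2 ^ r := by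
    have hopt := opt_initialSegment_le (ρ := 2 ^ r) (w := w) (k := k) fun a ha b hb =>
      hw.hammingDist_eq_dist (by omega) (by omega)
    have hk' : (k : ℝ) ≤ 2 ^ r := mod_cast hk
    push_cast at hopt
    linarith
  refine ⟨hopt_pos, (ENNReal.ofReal_le_ofReal ?_).trans
    (Network.ofReal_socialCost_div_opt_le_priceOfAnarchy hP hopt_pos)⟩
  rw [hcost, le_div_iff₀ hopt_pos]
  calc ((r : ℝ) + 1) / 8 * (rootedHypercube n (2 ^ r)).opt (initialSegment w (k + 1))
    _ ≤ (r + 1) / 8 * (2 * 2 ^ r) := by gcongr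
    _ ≤ ∑ a ∈ Finset.range (k + 1), (Nat.gcd a (2 ^ r) : ℝ) := by linarith

end IsZigZagWalk

theorem eighth_mul_log_le {r k : ℕ} (hk : k ≤ 2 ^ r) :
    1 / 8 * Real.log (k + 1) ≤ (r + 1) / 8 := by
  have hpow : (k : ℝ) + 1 ≤ 2 ^ (r + 1) := by
    exact_mod_cast show k + 1 ≤ 2 ^ (r + 1) by have := Nat.one_le_two_pow (n := r); omega
  have hlog : Real.log (k + 1) ≤ r + 1 := by
    calc Real.log (k + 1) ≤ Real.log (2 ^ (r + 1)) := Real.log_le_log (by positivity) hpow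
      _ = (r + 1) * Real.log 2 := by rw [Real.log_pow, Nat.cast_add_one]
      _ ≤ r + 1 := mul_le_of_le_one_right (by positivity) (by linarith [Real.log_two_lt_d9])
  linarith

theorem exists_forall_isOrdered_exists_isZigZagWalk {r k : ℕ} (hk : k ≤ 2 ^ r)
    (hrk : 2 ^ r < 2 * (k + 1)) :
    ∃ n, ∀ Ξ : GWSP (Option (Fin n → Bool)), Ξ.IsOrdered → ∃ w,
      IsZigZagWalk r (fun x => Ξ.rank (some x)) w ∧ (initialSegment w (k + 1)).card = k + 1 ∧
      0 < (rootedHypercube n (2 ^ r)).opt (initialSegment w (k + 1)) ∧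
      ENNReal.ofReal (1 / 8 * Real.log (k + 1)) ≤ (rootedHypercube n (2 ^ r)).priceOfAnarchy
        (Ξ.toProtocol (rootedHypercube n (2 ^ r))) (initialSegment w (k + 1)) := by
  obtain ⟨n, hn⟩ := exists_isZigZagWalk (β := ℕ) r
  refine ⟨n, fun Ξ hΞ => ?_⟩
  obtain ⟨w, hw⟩ := hn (fun x => Ξ.rank (some x)) (hΞ.comp (Option.some_injective _))
  obtain ⟨hopt, hpoa⟩ := hw.le_priceOfAnarchy hΞ hk hrk
  refine ⟨w, hw, card_initialSegment fun a ha b hb => ?_, hopt,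
    (ENNReal.ofReal_le_ofReal (eighth_mul_log_le hk)).trans hpoa⟩
  exact hw.hammingDist_eq_dist (by omega) (by omega)

end RootedHypercube

theorem mainTheorem2 :
    ∃ c : ℝ, 0 < c ∧
      (∀ k : ℕ, 2 ≤ k →
        ∃ (V : Type) (_ : Fintype V) (_ : DecidableEq V) (N : Network V),
          ∀ Ξ : GWSP V, Ξ.IsOrdered →
            ∃ S : Finset V, N.root ∉ S ∧ S.card = k ∧ 0 < N.opt S ∧
              ENNReal.ofReal (c * Real.log k) ≤ N.priceOfAnarchy (Ξ.toProtocol N) S) ∧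
      (∀ r : ℕ, 1 ≤ r → ∃ n : ℕ,
        ∀ Ξ : GWSP (Option (Fin n → Bool)), Ξ.IsOrdered →
          ∃ (p : Fin (2 ^ r + 1) → Fin n → Bool) (S : Finset (Option (Fin n → Bool))),
            IsIsometricPath p ∧ IsZigZag (fun a => Ξ.rank (some (p a))) ∧
            S = Finset.univ.image (fun a => some (p a)) ∧ S.card = 2 ^ r + 1 ∧
            0 < (rootedHypercube n (2 ^ r)).opt S ∧
            ENNReal.ofReal (c * Real.log (2 ^ r + 1)) ≤
              (rootedHypercube n (2 ^ r)).priceOfAnarchy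
                (Ξ.toProtocol (rootedHypercube n (2 ^ r))) S) := by
  refine ⟨1 / 8, by norm_num, fun k hk => ?_, fun r _ => ?_⟩
  · obtain ⟨m, hm, rfl⟩ : ∃ m, 1 ≤ m ∧ k = m + 1 := ⟨k - 1, by omega, by omega⟩
    have hpow_le : 2 ^ (Nat.log 2 m + 1) ≤ 2 * m := by
      rw [pow_succ']
      exact Nat.mul_le_mul_left 2 (Nat.pow_log_le_self 2 (by omega))
    obtain ⟨n, hn⟩ := exists_forall_isOrdered_exists_isZigZagWalk
      (Nat.lt_pow_succ_log_self one_lt_two m).le (by omega)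
    refine ⟨Option (Fin n → Bool), inferInstance, inferInstance,
      rootedHypercube n (2 ^ (Nat.log 2 m + 1)), fun Ξ hΞ => ?_⟩
    obtain ⟨w, -, hcard, hopt, hpoa⟩ := hn Ξ hΞ
    exact ⟨initialSegment w (m + 1), root_notMem_initialSegment, hcard, hopt, by simpa using hpoa⟩
  · obtain ⟨n, hn⟩ := exists_forall_isOrdered_exists_isZigZagWalk (r := r) le_rfl (by omega)
    refine ⟨n, fun Ξ hΞ => ?_⟩
    obtain ⟨w, hw, hcard, hopt, hpoa⟩ := hn Ξ hΞ
    exact ⟨fun a => w a, initialSegment w (2 ^ r + 1), hw.isIsometricPath, hw.isZigZag, rfl, hcard,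
      hopt, by simpa using hpoa⟩
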